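/- A matroid $\mathcal M$ on a finite set $E$ is regular if it is the column matroid over $\mathbb R$ of some $r\times E$ totally unimodular integer matrix $M$ of rank $r$ (such an $M$ is called a totally unimodular representation of $\mathcal M$). Given such an $M$, the lattice of integer flows is $\Lambda(\mathcal M)=\ker(M)\cap\mathbb Z^{E}$ and the lattice of integer cuts is $\Gamma(\mathcal M)=\mathrm{Row}(M)\cap\mathbb Z^{E}$, where $\ker(M)$ and $\mathrm{Row}(M)$ are the kernel and the row space of $M$ in $\mathbb R^{E}$; both lattices carry the bilinear form induced by the Euclidean dot product. Two lattices are isometric if there is an isomorphism of abelian groups between them that preserves the bilinear forms. For a matroid $\mathcal M$, let $\mathcal M_\bullet$ be the minor obtained by contracting all co-loops of $\mathcal M$, $\mathcal M^\circ$ the minor obtained by deleting all loops of $\mathcal M$, and $\mathcal M^*$ the dual matroid. **Corollary.** Let $\mathcal M$ and $\mathcal N$ be regular matroids. Then $(\mathcal N^\circ)^*=(\mathcal N^*)_\bullet$, and, for every choice of totally unimodular representations of $\mathcal M$ and $\mathcal N$, the lattices $\Lambda(\mathcal M)$ and $\Gamma(\mathcal N)$ are isometric if and only if $\mathcal M_\bullet$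 and $(\mathcal N^\circ)^*=(\mathcal N^*)_\bullet$ are isomorphic. -/

import Mathlib

open scoped Matrix

namespace Matroid

/-- An isomorphism of matroids exists: a bijection of the ground sets under which independent sets
correspond to independent sets. -/
def IsIsomorphic {α β : Type*} (M : Matroid α) (N : Matroid β) : Prop :=
  ∃ φ : M.E ≃ N.E, ∀ I : Set M.E,
    M.Indep (Subtype.val '' I) ↔ N.Indep (Subtype.val '' (φ '' I))

/-- The minor of `M` obtained by contracting all co-loops of `M`. -/
def contractColoops {α : Type*} (M : Matroid α) : Matroid α := M.contract M.coloops

/-- The minor of `M` obtained by deleting all loops of `M`. -/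
def deleteLoops {α : Type*} (M : Matroid α) : Matroid α := M.delete M.loops

/-- The integer matrix `A` (`r` rows, columns labelled by the ground set of `M`) is totally
unimodular, has rank `r`, and `M` is its column matroid over `ℝ`. -/
structure IsTURepresentation {α : Type*} (M : Matroid α) [Fintype M.E] {r : ℕ}
    (A : Matrix (Fin r) M.E ℤ) : Prop where
  isTotallyUnimodular : A.IsTotallyUnimodular
  rank_eq : (A.map (Int.cast : ℤ → ℝ)).rank = r
  indep_iff : ∀ I : Set M.E,
    M.Indep (Subtype.val '' I) ↔ LinearIndepOn ℝ (A.map (Int.cast : ℤ → ℝ)).col I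

/-- A regular matroid: the column matroid over `ℝ` of some `r`-by-`m` totally unimodular matrix of
rank `r`. -/
def IsRegular {α : Type*} (M : Matroid α) [Fintype M.E] : Prop :=
  ∃ (r : ℕ) (A : Matrix (Fin r) M.E ℤ), M.IsTURepresentation A

end Matroid

/-- The inclusion of `ℤ^E` in `ℝ^E`. -/
def intVecCast (E : Type*) : (E → ℤ) →+ (E → ℝ) := (Int.castAddHom ℝ).compLeft E

/-- The lattice of integer flows `ker A ∩ ℤ^E`, where `ker A` is the kernel in `ℝ^E`. -/
def flowLattice {r : ℕ} {E : Type*} [Fintype E] (A : Matrix (Fin r) E ℤ) : AddSubgroup (E → ℤ) :=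
  (LinearMap.ker (A.map (Int.cast : ℤ → ℝ)).mulVecLin).toAddSubgroup.comap (intVecCast E)

/-- The lattice of integer cuts `Row A ∩ ℤ^E`, where `Row A` is the row space in `ℝ^E`. -/
def cutLattice {r : ℕ} {E : Type*} (A : Matrix (Fin r) E ℤ) : AddSubgroup (E → ℤ) :=
  (Submodule.span ℝ (Set.range (A.map (Int.cast : ℤ → ℝ)).row)).toAddSubgroup.comap (intVecCast E)

/-- Two lattices of integer vectors, with the bilinear forms induced by the dot product, are
isometric: some isomorphism of abelian groups preserves the forms. -/
def LatticeIsometric {E F : Type*} [Fintype E] [Fintype F]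
    (L : AddSubgroup (E → ℤ)) (L' : AddSubgroup (F → ℤ)) : Prop :=
  ∃ ψ : L ≃+ L', ∀ x y : L, (ψ x : F → ℤ) ⬝ᵥ (ψ y : F → ℤ) = (x : E → ℤ) ⬝ᵥ (y : E → ℤ)

/-!
Total unimodularity enters only through rounding: a real flow or cut lies within distance less than
`1`, in every coordinate, of an integral one. Rounding `x / 2` shows that every class of such a
lattice `L` modulo `2L` contains a vector with entries in `{-1, 0, 1}`, so that the number of odd
entries of `x` is the least norm of a vector of `x + 2L`, and an isometry preserves it. That number
is half the sum of `1 - χ x` over the characters `χ` given by the parities of the coordinates; as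
distinct characters are linearly independent, an isometry matches the nontrivial parity characters
of the two lattices. The parities determine which sets of coordinates support no nonzero lattice
vector, that is, the matroid, up to the coordinates that vanish on the lattice, which are the
co-loops.

Conversely, after coordinates are deleted and relabelled two lattices with the same matroid have
standard representative matrices with the same zero pattern, and by Camion's uniqueness of signings
these agree up to signs of rows and columns, that is, up to an isometry. Cuts enter as the lattice
of the dual matroid.
-/

section IntegralSolutions

variable {m n : Type*} [Fintype n]

/-- The solutions of a linear system that lie in a box, a polytope whose extreme points are integral
when the system is totally unimodular and the data are integral. -/
def boxSolutions (A : Matrix m n ℝ) (b : m → ℝ) (l u : n → ℝ) : Set (n → ℝ) :=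
  {z ∈ Set.Icc l u | A *ᵥ z = b}

theorem isCompact_boxSolutions (A : Matrix m n ℝ) (b : m → ℝ) (l u : n → ℝ) :
    IsCompact (boxSolutions A b l u) :=
  isCompact_Icc.inter_right
    (isClosed_singleton.preimage (Continuous.matrix_mulVec continuous_const continuous_id))

theorem eventually_add_smul_mem_boxSolutions {A : Matrix m n ℝ} {b : m → ℝ} {l u z w : n → ℝ}
    (hz : z ∈ boxSolutions A b l u) (hw : A *ᵥ w = 0)
    (hsupp : ∀ e, w e ≠ 0 → z e ∈ Set.Ioo (l e) (u e)) :
    ∀ᶠ t in nhds (0 : ℝ), z + t • w ∈ boxSolutions A b l u := by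
  have hbox : ∀ e, ∀ᶠ t in nhds (0 : ℝ), z e + t * w e ∈ Set.Icc (l e) (u e) := by
    intro e
    by_cases he : w e = 0
    · simpa [he] using ⟨hz.1.1 e, hz.1.2 e⟩
    · have hcont : Filter.Tendsto (fun t : ℝ => z e + t * w e) (nhds 0) (nhds (z e)) :=
        Continuous.tendsto' (by fun_prop) _ _ (by simp)
      exact hcont.eventually (Icc_mem_nhds (hsupp e he).1 (hsupp e he).2)
  filter_upwards [Filter.eventually_all.2 hbox] with t ht
  refine ⟨⟨fun e => (ht e).1, fun e => (ht e).2⟩, ?_⟩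
  rw [Matrix.mulVec_add, Matrix.mulVec_smul, hw, smul_zero, add_zero, hz.2]

theorem linearIndepOn_col_iff {A : Matrix m n ℝ} {I : Set n} :
    LinearIndepOn ℝ A.col I ↔ ∀ z, A *ᵥ z = 0 → (∀ e ∉ I, z e = 0) → z = 0 := by
  have hcomb (c : n →₀ ℝ) : Finsupp.linearCombination ℝ A.col c = A *ᵥ c := by
    rw [Finsupp.linearCombination_apply, Finsupp.sum_fintype _ _ (by simp),
      Matrix.mulVec_eq_sum]
    simp only [op_smul_eq_smul]
    rfl
  simp only [linearIndepOn_iff, hcomb, Finsupp.mem_supported']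
  refine ⟨fun h z hz hzI => ?_, fun h c hcI hc => DFunLike.coe_injective (h c hc hcI)⟩
  obtain ⟨c, rfl⟩ := Finsupp.equivFunOnFinite.surjective z
  exact congrArg DFunLike.coe (h c hzI hz)

theorem linearIndepOn_col_of_mem_extremePoints {A : Matrix m n ℝ} {b : m → ℝ} {l u z : n → ℝ}
    (hz : z ∈ (boxSolutions A b l u).extremePoints ℝ) :
    LinearIndepOn ℝ A.col {e | z e ∈ Set.Ioo (l e) (u e)} := by
  refine linearIndepOn_col_iff.2 fun w hw hsupp => ?_
  have hmem := eventually_add_smul_mem_boxSolutions hz.1 hw fun e he => by_contra (he <| hsupp e ·)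
  have hmem' := (continuous_neg.tendsto' (0 : ℝ) 0 neg_zero).eventually hmem
  have hboth := (hmem.and hmem').filter_mono (nhdsWithin_le_nhds (s := Set.Ioi 0))
  obtain ⟨t, ⟨hadd, hsub⟩, ht⟩ := (hboth.and self_mem_nhdsWithin).exists
  have hmid : z ∈ openSegment ℝ (z + t • w) (z + -t • w) := by
    refine ⟨1 / 2, 1 / 2, by norm_num, by norm_num, by norm_num, ?_⟩
    module
  have heq : z + t • w = z := hz.2 hadd hsub hmid
  exact (smul_eq_zero.1 (add_eq_left.1 heq)).resolve_left (ne_of_gt ht)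

theorem exists_isUnit_det_submatrix {K : Type*} [Field K] [Finite m] [DecidableEq n]
    {A : Matrix m n K} (hA : LinearIndependent K A.col) :
    ∃ f : n → m, IsUnit (A.submatrix f id).det := by
  have := Fintype.ofFinite m
  obtain ⟨κ, a, ha, hspan, hrow⟩ := exists_linearIndependent' K A.row
  have : Fintype κ := Fintype.ofInjective a ha
  have hcard : Fintype.card n = Fintype.card κ := by
    have hrank : A.rank = Fintype.card n := by
      rw [← Matrix.rank_transpose]
      exact LinearIndependent.rank_matrix hA
    rw [← hrank, Matrix.rank_eq_finrank_span_row, ← hspan,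
      linearIndependent_iff_card_eq_finrank_span.mp hrow, Set.finrank]
  let σ : n ≃ κ := Fintype.equivOfCardEq hcard
  refine ⟨a ∘ σ, (Matrix.isUnit_iff_isUnit_det _).1 ?_⟩
  exact Matrix.linearIndependent_rows_iff_isUnit.1 (hrow.comp σ σ.injective)

theorem intVecCast_apply {E : Type*} (x : E → ℤ) (e : E) : intVecCast E x e = x e := rfl

theorem intVecCast_injective (E : Type*) : Function.Injective (intVecCast E) :=
  Int.cast_injective.comp_left

theorem map_intCast_mulVec (A : Matrix m n ℤ) (w : n → ℤ) :
    A.map (Int.cast : ℤ → ℝ) *ᵥ intVecCast n w = intVecCast m (A *ᵥ w) :=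
  funext fun i => (RingHom.map_mulVec (Int.castRingHom ℝ) A w i).symm

variable [Finite m] {A : Matrix m n ℤ}

theorem isUnit_det_of_isTotallyUnimodular [DecidableEq n] {S : Matrix n n ℤ}
    (hS : S.IsTotallyUnimodular) (hdet : S.det ≠ 0) : IsUnit S.det := by
  obtain ⟨s, hs⟩ := (Matrix.isTotallyUnimodular_iff_fintype S).1 hS n id id
  rw [Matrix.submatrix_id_id] at hs
  cases s <;> simp_all [← hs]

theorem exists_intVecCast_eq_of_linearIndependent_col (hA : A.IsTotallyUnimodular)
    (hcol : LinearIndependent ℝ (A.map (Int.cast : ℤ → ℝ)).col) {z : n → ℝ} {b : m → ℤ}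
    (hz : A.map (Int.cast : ℤ → ℝ) *ᵥ z = intVecCast m b) : ∃ w, intVecCast n w = z := by
  classical
  obtain ⟨f, hf⟩ := exists_isUnit_det_submatrix hcol
  set S := A.submatrix f id
  have hdet : S.det ≠ 0 := fun h => hf.ne_zero <|
    (RingHom.map_det (Int.castRingHom ℝ) S).symm.trans (by rw [h, map_zero])
  have hunit := isUnit_det_of_isTotallyUnimodular (hA.submatrix f id) hdet
  refine ⟨S⁻¹ *ᵥ (b ∘ f),
    Matrix.mulVec_injective_of_isUnit ((Matrix.isUnit_iff_isUnit_det _).2 hf) ?_⟩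
  calc S.map (Int.cast : ℤ → ℝ) *ᵥ intVecCast n (S⁻¹ *ᵥ (b ∘ f))
      = intVecCast n (b ∘ f) := by
        rw [map_intCast_mulVec, Matrix.mulVec_mulVec, Matrix.mul_nonsing_inv S hunit,
          Matrix.one_mulVec]
    _ = S.map (Int.cast : ℤ → ℝ) *ᵥ z := funext fun i => (congrFun hz (f i)).symm

theorem exists_intVecCast_eq_of_linearIndepOn_col (hA : A.IsTotallyUnimodular) {J : Set n}
    (hJ : LinearIndepOn ℝ (A.map (Int.cast : ℤ → ℝ)).col J) {z : n → ℝ} {b : m → ℤ}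
    (hz : A.map (Int.cast : ℤ → ℝ) *ᵥ z = intVecCast m b) (hsupp : ∀ e ∉ J, z e = 0) :
    ∃ w, intVecCast n w = z := by
  classical
  have hzJ : (A.submatrix id ((↑) : J → n)).map (Int.cast : ℤ → ℝ) *ᵥ (z ∘ (↑)) =
      intVecCast m b := by
    rw [← hz]
    ext i
    exact (Finset.sum_congr_set J (fun e => (A i e : ℝ) * z e) (fun e => A i e * z e)
      (fun _ _ => rfl) fun e he => by rw [hsupp e he, mul_zero]).symm
  obtain ⟨w, hw⟩ :=
    exists_intVecCast_eq_of_linearIndependent_col (hA.submatrix id ((↑) : J → n)) hJ hzJ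
  refine ⟨fun e => ⌊z e⌋, funext fun e => ?_⟩
  by_cases he : e ∈ J
  · simp [intVecCast_apply, ← show (w ⟨e, he⟩ : ℝ) = z e from congrFun hw ⟨e, he⟩]
  · simp [intVecCast_apply, hsupp e he]

theorem exists_int_mem_Icc_mulVec_eq (hA : A.IsTotallyUnimodular) {b : m → ℤ} {l u : n → ℤ}
    {z : n → ℝ} (hz : A.map (Int.cast : ℤ → ℝ) *ᵥ z = intVecCast m b)
    (hbox : z ∈ Set.Icc (intVecCast n l) (intVecCast n u)) :
    ∃ w ∈ Set.Icc l u, A *ᵥ w = b := by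
  classical
  obtain ⟨y, hy⟩ := (isCompact_boxSolutions (A.map Int.cast) (intVecCast m b) (intVecCast n l)
    (intVecCast n u)).extremePoints_nonempty ⟨z, hbox, hz⟩
  obtain ⟨⟨⟨hly, hyu⟩, hyb⟩, -⟩ := id hy
  set J : Set n := {e | y e ∈ Set.Ioo (l e : ℝ) (u e)}
  have hcol : LinearIndepOn ℝ (A.map (Int.cast : ℤ → ℝ)).col J :=
    linearIndepOn_col_of_mem_extremePoints hy
  let v : n → ℤ := fun e => if y e ∈ Set.Ioo (l e : ℝ) (u e) then 0 else ⌊y e⌋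
  have hv : ∀ e ∉ J, (v e : ℝ) = y e := by
    intro e he
    have hend : y e = l e ∨ y e = u e := by
      by_contra! h
      exact he ⟨(hly e).lt_of_ne' h.1, (hyu e).lt_of_ne h.2⟩
    simp only [v, if_neg (show ¬ y e ∈ Set.Ioo (l e : ℝ) (u e) from he)]
    rcases hend with h | h <;> simp [h]
  have hsupp : ∀ e ∉ J, (y - intVecCast n v) e = 0 := fun e he => sub_eq_zero.2 (hv e he).symm
  have hsub : A.map (Int.cast : ℤ → ℝ) *ᵥ (y - intVecCast n v) = intVecCast m (b - A *ᵥ v) := by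
    rw [Matrix.mulVec_sub, hyb, map_intCast_mulVec, map_sub]
  obtain ⟨w, hw⟩ := exists_intVecCast_eq_of_linearIndepOn_col hA hcol hsub hsupp
  have hy' : intVecCast n (w + v) = y := by rw [map_add, hw, sub_add_cancel]
  refine ⟨w + v, ⟨fun e => ?_, fun e => ?_⟩, intVecCast_injective m ?_⟩
  · exact Int.cast_le.1 ((hly e).trans_eq (congrFun hy' e).symm)
  · exact Int.cast_le.1 ((congrFun hy' e).trans_le (hyu e))
  · rw [← map_intCast_mulVec, hy', hyb]

theorem exists_int_mulVec_eq_and_abs_sub_lt_one (hA : A.IsTotallyUnimodular) {b : m → ℤ}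
    {z : n → ℝ} (hz : A.map (Int.cast : ℤ → ℝ) *ᵥ z = intVecCast m b) :
    ∃ w : n → ℤ, A *ᵥ w = b ∧ ∀ e, |z e - w e| < 1 := by
  obtain ⟨w, hw, hwb⟩ := exists_int_mem_Icc_mulVec_eq hA hz (l := fun e => ⌊z e⌋)
    (u := fun e => ⌈z e⌉) ⟨fun e => Int.floor_le _, fun e => Int.le_ceil _⟩
  refine ⟨w, hwb, fun e => abs_sub_lt_iff.2 ⟨?_, ?_⟩⟩
  · have hle : (⌊z e⌋ : ℝ) ≤ w e := mod_cast hw.1 e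
    linarith [Int.lt_floor_add_one (z e)]
  · have hle : (w e : ℝ) ≤ ⌈z e⌉ := mod_cast hw.2 e
    linarith [Int.ceil_lt_add_one (z e)]

end IntegralSolutions

/-- Every vector of the subspace `V` can be rounded inside `V`: some integer vector of `V` differs
from it by less than one in each coordinate. This is the only consequence of total unimodularity
that the isometry criterion needs. -/
def HasRounding {E : Type*} (V : Submodule ℝ (E → ℝ)) : Prop :=
  ∀ z ∈ V, ∃ w : E → ℤ, intVecCast E w ∈ V ∧ ∀ e, |z e - w e| < 1

/-- The lattice of integer vectors of a real subspace; flow and cut lattices are of this form. -/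
def integerPoints {E : Type*} (V : Submodule ℝ (E → ℝ)) : AddSubgroup (E → ℤ) :=
  V.toAddSubgroup.comap (intVecCast E)

/-- An intrinsic form of the regularity of a lattice of integer vectors: every class of `L` modulo
`2L` contains a vector with entries in `{-1, 0, 1}`. -/
def IsRegularLattice {E : Type*} (L : AddSubgroup (E → ℤ)) : Prop :=
  ∀ x ∈ L, ∃ y ∈ L, ∃ z ∈ L, (∀ e, |y e| ≤ 1) ∧ x = y + (2 : ℤ) • z

/-- No nonzero vector of `L` is supported in `I`. For the integer flows of a matrix this says that
the columns in `I` are linearly independent. -/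
def SupportIndep {E : Type*} (L : AddSubgroup (E → ℤ)) (I : Set E) : Prop :=
  ∀ x ∈ L, (∀ e ∉ I, x e = 0) → x = 0

section Rounding

variable {E m : Type*} [Finite m]

theorem hasRounding_ker [Fintype E] {A : Matrix m E ℤ} (hA : A.IsTotallyUnimodular) :
    HasRounding (LinearMap.ker (A.map (Int.cast : ℤ → ℝ)).mulVecLin) := by
  intro z hz
  obtain ⟨w, hw, hclose⟩ := exists_int_mulVec_eq_and_abs_sub_lt_one hA (b := 0)
    (z := z) (by rw [map_zero]; exact hz)
  refine ⟨w, ?_, hclose⟩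
  rw [LinearMap.mem_ker, Matrix.mulVecLin_apply, map_intCast_mulVec, hw, map_zero]

theorem hasRounding_span_row [Finite E] {A : Matrix m E ℤ} (hA : A.IsTotallyUnimodular) :
    HasRounding (Submodule.span ℝ (Set.range (A.map (Int.cast : ℤ → ℝ)).row)) := by
  classical
  have := Fintype.ofFinite E
  have := Fintype.ofFinite m
  rw [← range_vecMulLinear]
  rintro _ ⟨p, rfl⟩
  have hT := (Matrix.fromCols_one_isTotallyUnimodular_iff Aᵀ).2 hA.transpose
  obtain ⟨w, hw, hclose⟩ := exists_int_mulVec_eq_and_abs_sub_lt_one hT (b := 0)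
    (z := Sum.elim p (-(p ᵥ* A.map Int.cast))) (by
      rw [Matrix.fromCols_map, Matrix.fromCols_mulVec, Matrix.map_one _ Int.cast_zero Int.cast_one,
        Sum.elim_comp_inl, Sum.elim_comp_inr, Matrix.one_mulVec, Matrix.transpose_map,
        Matrix.mulVec_transpose, add_neg_cancel, map_zero])
  rw [Matrix.fromCols_mulVec, Matrix.one_mulVec, add_eq_zero_iff_neg_eq'] at hw
  refine ⟨-(w ∘ Sum.inr), ⟨intVecCast m (w ∘ Sum.inl), ?_⟩, fun e => ?_⟩
  · rw [Matrix.vecMulLinear_apply, ← Matrix.mulVec_transpose, ← Matrix.transpose_map,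
      map_intCast_mulVec, hw]
  · have h := hclose (Sum.inr e)
    rw [Sum.elim_inr, ← abs_neg] at h
    convert h using 2
    simp
    ring

end Rounding

namespace HasRounding

variable {E : Type*} {V : Submodule ℝ (E → ℝ)}

theorem isRegularLattice (hV : HasRounding V) : IsRegularLattice (integerPoints V) := by
  intro x hx
  obtain ⟨w, hw, hclose⟩ := hV _ (V.smul_mem (1 / 2) hx)
  refine ⟨x - (2 : ℤ) • w, sub_mem hx (zsmul_mem (show w ∈ integerPoints V from hw) 2), w, hw,
    fun e => ?_, (sub_add_cancel _ _).symm⟩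
  have hlt := abs_sub_lt_iff.1 (hclose e)
  simp only [Pi.smul_apply, intVecCast_apply, smul_eq_mul] at hlt
  have hupper : x e - 2 * w e < 2 := by exact_mod_cast (by linarith : (x e - 2 * w e : ℝ) < 2)
  have hlower : -2 < x e - 2 * w e := by exact_mod_cast (by linarith : (-2 : ℝ) < x e - 2 * w e)
  simp only [Pi.sub_apply, Pi.smul_apply, smul_eq_mul, abs_le]
  omega

theorem supportIndep_iff (hV : HasRounding V) {I : Set E} :
    SupportIndep (integerPoints V) I ↔ ∀ z ∈ V, (∀ e ∉ I, z e = 0) → z = 0 := by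
  refine ⟨fun h z hz hzI => funext fun e => by_contra fun he => ?_, fun h x hx hxI => ?_⟩
  · -- Scaled to have an entry `1`, the vector `z` rounds to a nonzero vector with no more support.
    obtain ⟨w, hw, hclose⟩ := hV _ (V.smul_mem (z e)⁻¹ hz)
    simp only [Pi.smul_apply, smul_eq_mul] at hclose
    have hwI : ∀ i ∉ I, w i = 0 := fun i hi => by
      have hi' := hclose i
      rw [hzI i hi, mul_zero, zero_sub, abs_neg] at hi'
      exact Int.abs_lt_one_iff.1 (mod_cast hi')
    have he' := hclose e
    rw [h w hw hwI, inv_mul_cancel₀ he] at he'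
    norm_num at he'
  · refine intVecCast_injective E ((h _ hx fun e he => ?_).trans (map_zero _).symm)
    rw [intVecCast_apply, hxI e he, Int.cast_zero]

end HasRounding

namespace IsRegularLattice

variable {E : Type*} {L : AddSubgroup (E → ℤ)}

theorem exists_sign_vector (hL : IsRegularLattice L) {x : E → ℤ} (hx : x ∈ L) {e : E}
    (he : x e ≠ 0) : ∃ y ∈ L, (∀ i, |y i| ≤ 1) ∧ y e = 1 ∧ ∀ i, x i = 0 → y i = 0 := by
  induction hk : (x e).natAbs using Nat.strong_induction_on generalizing x with
  | _ k ih =>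
    obtain ⟨y, hy, z, hz, hbound, rfl⟩ := hL x hx
    have hzero : ∀ i, (y + (2 : ℤ) • z) i = 0 → y i = 0 ∧ z i = 0 := by
      intro i hi
      have := abs_le.1 (hbound i)
      simp only [Pi.add_apply, Pi.smul_apply, smul_eq_mul] at hi
      omega
    have hye := abs_le.1 (hbound e)
    obtain hye | hye | hye : y e = 1 ∨ y e = -1 ∨ y e = 0 := by omega
    · exact ⟨y, hy, hbound, hye, fun i hi => (hzero i hi).1⟩
    · refine ⟨-y, neg_mem hy, fun i => ?_, ?_, fun i hi => ?_⟩
      · simpa using hbound i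
      · simp [hye]
      · simp [(hzero i hi).1]
    · simp only [Pi.add_apply, Pi.smul_apply, smul_eq_mul, hye] at he hk
      obtain ⟨v, hv, hvbound, hve, hvz⟩ := ih _ (by omega) hz (by omega) rfl
      exact ⟨v, hv, hvbound, hve, fun i hi => hvz i (hzero i hi).2⟩

theorem supportIndep_iff_even (hL : IsRegularLattice L) {I : Set E} :
    SupportIndep L I ↔
      ∀ x : L, (∀ e ∉ I, Even ((x : E → ℤ) e)) → ∀ e, Even ((x : E → ℤ) e) := by
  refine ⟨fun h x hxI => ?_, fun h x hx hxI => funext fun e => by_contra fun he => ?_⟩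
  · obtain ⟨y, hy, z, -, hbound, hx⟩ := hL x x.2
    rw [hx] at hxI ⊢
    have hy0 : y = 0 := h y hy fun e he => by
      obtain ⟨k, hk⟩ := hxI e he
      have := abs_le.1 (hbound e)
      simp only [Pi.add_apply, Pi.smul_apply, smul_eq_mul] at hk
      omega
    exact fun e => by simp [hy0]
  · obtain ⟨y, hy, -, hye, hsupp⟩ := hL.exists_sign_vector hx he
    have heven := h ⟨y, hy⟩ (fun i hi => by simp [hsupp i (hxI i hi)]) e
    simp [hye] at heven

end IsRegularLattice

section Characters

/-- The parity of `f` as the character `g ↦ (-1) ^ f g`, with values in a domain so that linear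
independence of characters applies. -/
def parityChar {G : Type*} [AddGroup G] (f : G →+ ℤ) : Multiplicative G →* ℤ :=
  (Units.coeHom ℤ).comp ((zpowersHom ℤˣ (-1)).comp f.toMultiplicative)

theorem one_sub_parityChar {G : Type*} [AddGroup G] (f : G →+ ℤ) (g : G) :
    1 - parityChar f (.ofAdd g) = 2 * if Odd (f g) then 1 else 0 := by
  have happly : parityChar f (.ofAdd g) = ((f g).negOnePow : ℤ) := rfl
  split_ifs with h
  · rw [happly, Int.negOnePow_odd _ h]; norm_num
  · rw [happly, Int.negOnePow_even _ (Int.not_odd_iff_even.1 h)]; norm_num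

theorem odd_iff_odd_of_parityChar_eq {G : Type*} [AddGroup G] {f f' : G →+ ℤ}
    (h : parityChar f = parityChar f') (g : G) : Odd (f g) ↔ Odd (f' g) := by
  have hg := (one_sub_parityChar f g).symm.trans (h ▸ one_sub_parityChar f' g)
  split_ifs at hg with hf hf' hf'
  · exact iff_of_true hf hf'
  · norm_num at hg
  · norm_num at hg
  · exact iff_of_false hf hf'

theorem parityChar_ne_one {G : Type*} [AddGroup G] {f : G →+ ℤ} {g : G} (hg : Odd (f g)) :
    parityChar f ≠ 1 := by
  intro h
  have hfg := one_sub_parityChar f g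
  rw [h, if_pos hg] at hfg
  norm_num at hfg

theorem exists_equiv_of_sum_one_sub_eq {G K E F : Type*} [Monoid G] [CommRing K] [IsDomain K]
    [CharZero K] [Fintype E] [Fintype F] {χ : E → G →* K} {η : F → G →* K} (hχ : ∀ e, χ e ≠ 1)
    (hη : ∀ f, η f ≠ 1) (hsum : ∀ g, ∑ e, (1 - χ e g) = ∑ f, (1 - η f g)) :
    ∃ φ : E ≃ F, ∀ e, η (φ e) = χ e := by
  classical
  let p : (G →* K) →₀ K :=
    ∑ e, (.single 1 1 - .single (χ e) 1) - ∑ f, (.single 1 1 - .single (η f) 1)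
  have hp : p = 0 := by
    refine linearIndependent_iff.1 (linearIndependent_monoidHom G K) p (funext fun g => ?_)
    have hg := sub_eq_zero.2 (hsum g)
    simpa [p] using hg
  have hcard (c : G →* K) : Fintype.card {e // χ e = c} = Fintype.card {f // η f = c} := by
    by_cases hc : c = 1
    · have : IsEmpty {e // χ e = c} := ⟨fun e => hχ e (e.2.trans hc)⟩
      have : IsEmpty {f // η f = c} := ⟨fun f => hη f (f.2.trans hc)⟩
      simp only [Fintype.card_eq_zero]
    · have hpc := DFunLike.congr_fun hp c
      simp only [p, Finsupp.single_apply, Ne.symm hc, Finsupp.sub_apply, Finsupp.finsetSum_apply,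
        Finsupp.zero_apply, if_false, zero_sub, Finset.sum_neg_distrib, Finset.sum_boole,
        sub_neg_eq_add, neg_add_eq_zero, Nat.cast_inj] at hpc
      rw [Fintype.card_subtype, Fintype.card_subtype, hpc]
  let σ c := Fintype.equivOfCardEq (hcard c)
  exact ⟨Equiv.ofFiberEquiv σ, Equiv.ofFiberEquiv_map σ⟩

end Characters

section Isometry

open scoped Finset

variable {E F : Type*} [Fintype E] [Fintype F] {L : AddSubgroup (E → ℤ)} {L' : AddSubgroup (F → ℤ)}

theorem card_odd_le_dotProduct_self (x : E → ℤ) : (#{e | Odd (x e)} : ℤ) ≤ x ⬝ᵥ x := by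
  rw [Finset.card_filter, Nat.cast_sum]
  refine Finset.sum_le_sum fun e _ => ?_
  split_ifs with h
  · have hne : x e ≠ 0 := fun h0 => by simp [h0] at h
    exact_mod_cast mul_self_pos.2 hne
  · exact_mod_cast mul_self_nonneg (x e)

theorem dotProduct_self_eq_card_odd {x : E → ℤ} (hx : ∀ e, |x e| ≤ 1) :
    x ⬝ᵥ x = #{e | Odd (x e)} := by
  rw [Finset.card_filter, Nat.cast_sum]
  refine Finset.sum_congr rfl fun e _ => ?_
  have := abs_le.1 (hx e)
  obtain h | h | h : x e = 1 ∨ x e = -1 ∨ x e = 0 := by omega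
  all_goals simp [h]

/-- The number of odd entries of `x` is the least norm of a vector of `x + 2L`. -/
theorem IsRegularLattice.card_odd_map_le (hL : IsRegularLattice L) {ψ : L →+ L'}
    (hψ : ∀ x, (ψ x : F → ℤ) ⬝ᵥ ψ x = (x : E → ℤ) ⬝ᵥ x) (x : L) :
    #{f | Odd ((ψ x : F → ℤ) f)} ≤ #{e | Odd ((x : E → ℤ) e)} := by
  obtain ⟨y, hy, z, hz, hbound, hx⟩ := hL x x.2
  obtain rfl : x = ⟨y, hy⟩ + (2 : ℤ) • ⟨z, hz⟩ := Subtype.ext hx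
  have hodd := (card_odd_le_dotProduct_self (ψ ⟨y, hy⟩ : F → ℤ)).trans_eq
    ((hψ _).trans (dotProduct_self_eq_card_odd hbound))
  simpa [Int.odd_add, parity_simps] using hodd

theorem LatticeIsometric.symm (h : LatticeIsometric L L') : LatticeIsometric L' L := by
  obtain ⟨ψ, hψ⟩ := h
  exact ⟨ψ.symm, fun x y => by simpa using (hψ (ψ.symm x) (ψ.symm y)).symm⟩

theorem LatticeIsometric.trans {F' : Type*} [Fintype F'] {L'' : AddSubgroup (F' → ℤ)}
    (h : LatticeIsometric L L') (h' : LatticeIsometric L' L'') : LatticeIsometric L L'' := by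
  obtain ⟨ψ, hψ⟩ := h
  obtain ⟨ψ', hψ'⟩ := h'
  exact ⟨ψ.trans ψ', fun x y => (hψ' _ _).trans (hψ x y)⟩

/-- Every coordinate takes a nonzero value on the lattice; for flow lattices this says that the
matroid has no co-loops. -/
def HasFullSupport {E : Type*} (L : AddSubgroup (E → ℤ)) : Prop :=
  ∀ e, ∃ x ∈ L, x e ≠ 0

/-- The `e`-th coordinate as an additive map on the lattice, the source of its parity characters. -/
def coordHom {E : Type*} (L : AddSubgroup (E → ℤ)) (e : E) : L →+ ℤ :=
  (Pi.evalAddMonoidHom (fun _ => ℤ) e).comp L.subtype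

theorem IsRegularLattice.exists_odd {E : Type*} {L : AddSubgroup (E → ℤ)} (hL : IsRegularLattice L)
    (hfull : HasFullSupport L) (e : E) : ∃ x : L, Odd ((x : E → ℤ) e) := by
  obtain ⟨x, hx, he⟩ := hfull e
  obtain ⟨y, hy, -, hye, -⟩ := hL.exists_sign_vector hx he
  exact ⟨⟨y, hy⟩, by simp [hye]⟩

theorem LatticeIsometric.exists_equiv_odd_iff (h : LatticeIsometric L L')
    (hL : IsRegularLattice L) (hL' : IsRegularLattice L') (hfull : HasFullSupport L)
    (hfull' : HasFullSupport L') :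
    ∃ (ψ : L ≃+ L') (φ : E ≃ F), ∀ x e, Odd ((ψ x : F → ℤ) (φ e)) ↔ Odd ((x : E → ℤ) e) := by
  obtain ⟨ψ, hψ⟩ := h
  have hcard (x : L) : #{e | Odd ((x : E → ℤ) e)} = #{f | Odd ((ψ x : F → ℤ) f)} := by
    refine le_antisymm ?_ (hL.card_odd_map_le (ψ := ψ.toAddMonoidHom) (fun x => hψ x x) x)
    simpa using hL'.card_odd_map_le (ψ := ψ.symm.toAddMonoidHom)
      (fun y => by simpa using (hψ (ψ.symm y) (ψ.symm y)).symm) (ψ x)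
  let χ e := parityChar (coordHom L e)
  let η f := parityChar ((coordHom L' f).comp ψ.toAddMonoidHom)
  have hχ e : χ e ≠ 1 := parityChar_ne_one (hL.exists_odd hfull e).choose_spec
  have hη f : η f ≠ 1 := by
    obtain ⟨y, hy⟩ := hL'.exists_odd hfull' f
    obtain ⟨x, rfl⟩ := ψ.surjective y
    exact parityChar_ne_one (g := x) hy
  have hsum (x : Multiplicative L) : ∑ e, (1 - χ e x) = ∑ f, (1 - η f x) := by
    calc ∑ e, (1 - χ e x) = 2 * #{e | Odd ((x.toAdd : E → ℤ) e)} := by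
          rw [← Finset.sum_boole, Finset.mul_sum]
          exact Finset.sum_congr rfl fun e _ => one_sub_parityChar _ x.toAdd
      _ = 2 * #{f | Odd ((ψ x.toAdd : F → ℤ) f)} := by rw [hcard]
      _ = ∑ f, (1 - η f x) := by
          rw [← Finset.sum_boole, Finset.mul_sum]
          exact Finset.sum_congr rfl fun f _ =>
            (one_sub_parityChar ((coordHom L' f).comp ψ.toAddMonoidHom) x.toAdd).symm
  obtain ⟨φ, hφ⟩ := exists_equiv_of_sum_one_sub_eq hχ hη hsum
  exact ⟨ψ, φ, fun x e => odd_iff_odd_of_parityChar_eq (hφ e) x⟩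

theorem LatticeIsometric.exists_equiv_supportIndep_iff (h : LatticeIsometric L L')
    (hL : IsRegularLattice L) (hL' : IsRegularLattice L') (hfull : HasFullSupport L)
    (hfull' : HasFullSupport L') :
    ∃ φ : E ≃ F, ∀ I, SupportIndep L I ↔ SupportIndep L' (φ '' I) := by
  obtain ⟨ψ, φ, hφ⟩ := h.exists_equiv_odd_iff hL hL' hfull hfull'
  refine ⟨φ, fun I => ?_⟩
  have heven (x : L) e : Even ((x : E → ℤ) e) ↔ Even ((ψ x : F → ℤ) (φ e)) := by
    rw [← Int.not_odd_iff_even, ← hφ, Int.not_odd_iff_even]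
  calc SupportIndep L I
      ↔ ∀ x : L, (∀ e ∉ I, Even ((x : E → ℤ) e)) → ∀ e, Even ((x : E → ℤ) e) :=
        hL.supportIndep_iff_even
    _ ↔ ∀ x : L, (∀ f ∉ φ '' I, Even ((ψ x : F → ℤ) f)) → ∀ f, Even ((ψ x : F → ℤ) f) := by
        simp only [heven, φ.surjective.forall, φ.injective.mem_set_image]
    _ ↔ ∀ y : L', (∀ f ∉ φ '' I, Even ((y : F → ℤ) f)) → ∀ f, Even ((y : F → ℤ) f) :=
        ⟨fun h y => ψ.apply_symm_apply y ▸ h (ψ.symm y), fun h x => h (ψ x)⟩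
    _ ↔ SupportIndep L' (φ '' I) := hL'.supportIndep_iff_even.symm

end Isometry

section Camion

variable {R C : Type*}

/-- The signing condition of Ghouila-Houri: every set of rows can be signed so that the signed sum
has entries in `{-1, 0, 1}`. -/
def IsGhouilaHouri (D : Matrix R C ℤ) : Prop :=
  ∀ T : Finset R, ∃ q : R → ℤˣ, ∀ j, |∑ i ∈ T, (q i : ℤ) * D i j| ≤ 1

/-- The graph on the rows in which two rows are adjacent when some column in `S` is nonzero in both;
its paths carry the signs from one row to another. -/
def rowGraph (D : Matrix R C ℤ) (S : Finset C) : SimpleGraph R :=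
  SimpleGraph.fromRel fun i k => ∃ j ∈ S, D i j ≠ 0 ∧ D k j ≠ 0

theorem rowGraph_adj {D : Matrix R C ℤ} {S : Finset C} {i k : R} :
    (rowGraph D S).Adj i k ↔ i ≠ k ∧ ∃ j ∈ S, D i j ≠ 0 ∧ D k j ≠ 0 := by
  simp only [rowGraph, SimpleGraph.fromRel_adj, and_comm (a := D k _ ≠ 0), or_self]

theorem IsGhouilaHouri.abs_apply_le_one {D : Matrix R C ℤ} (hD : IsGhouilaHouri D) (i : R) (j : C) :
    |D i j| ≤ 1 := by
  obtain ⟨q, hq⟩ := hD {i}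
  simpa [abs_mul, Int.isUnit_iff_abs_eq.1 (q i).isUnit] using hq j

theorem IsGhouilaHouri.exists_mul_eq_neg_mul {D : Matrix R C ℤ} (hD : IsGhouilaHouri D)
    (T : Finset R) : ∃ q : R → ℤˣ, ∀ i ∈ T, ∀ k ∈ T, ∀ j, i ≠ k → D i j ≠ 0 → D k j ≠ 0 →
      (∀ l ∈ T, D l j ≠ 0 → l = i ∨ l = k) → (q i : ℤ) * D i j = -(q k * D k j) := by
  classical
  obtain ⟨q, hq⟩ := hD T
  refine ⟨q, fun i hi k hk j hik hij hkj honly => ?_⟩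
  have hsum : ∑ l ∈ T, (q l : ℤ) * D l j = q i * D i j + q k * D k j := by
    refine Finset.sum_eq_add_of_mem i k hi hk hik fun l hl hne => ?_
    rw [by_contra fun h => (honly l hl h).elim hne.1 hne.2, mul_zero]
  have hle := abs_le.1 (hsum ▸ hq j)
  have hi1 := abs_le.1 (hD.abs_apply_le_one i j)
  have hk1 := abs_le.1 (hD.abs_apply_le_one k j)
  rcases Int.units_eq_one_or (q i) with h | h <;> rcases Int.units_eq_one_or (q k) with h' | h' <;>
    simp only [h, h', Units.val_one, Units.val_neg, one_mul, neg_mul] at hle ⊢ <;> omega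

/-- Multiplying the signings of `T` for two matrices with the same support cancels the entries:
only their ratio `s` is left. -/
theorem IsGhouilaHouri.exists_mul_eq_mul {D : Matrix R C ℤ} {s : R → C → ℤˣ}
    (hD : IsGhouilaHouri D) (hD' : IsGhouilaHouri (.of fun i j => s i j * D i j)) (T : Finset R) :
    ∃ p : R → ℤˣ, ∀ i ∈ T, ∀ k ∈ T, ∀ j, i ≠ k → D i j ≠ 0 → D k j ≠ 0 →
      (∀ l ∈ T, D l j ≠ 0 → l = i ∨ l = k) → p i * s i j = p k * s k j := by
  obtain ⟨q, hq⟩ := hD.exists_mul_eq_neg_mul T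
  obtain ⟨q', hq'⟩ := hD'.exists_mul_eq_neg_mul T
  refine ⟨q * q', fun i hi k hk j hik hij hkj honly => ?_⟩
  have h := hq i hi k hk j hik hij hkj honly
  have h' := hq' i hi k hk j hik (by simpa using hij) (by simpa using hkj) (by simpa using honly)
  simp only [Matrix.of_apply] at h'
  have hsq : ∀ l, D l j ≠ 0 → D l j * D l j = 1 := fun l hl => by
    have := abs_le.1 (hD.abs_apply_le_one l j)
    obtain h | h : D l j = 1 ∨ D l j = -1 := by omega
    all_goals rw [h]; norm_num
  refine Units.ext ?_
  have hmul := congrArg₂ (· * ·) h h'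
  push_cast [Pi.mul_apply]
  linear_combination hmul + (q k * q' k * s k j : ℤ) * hsq k hkj -
    (q i * q' i * s i j : ℤ) * hsq i hij

theorem le_add_one_of_length_eq_dist {V : Type*} {G : SimpleGraph V} {u v : V} {w : G.Walk u v}
    (hw : w.length = G.dist u v) {i j : ℕ} (hj : j ≤ w.length)
    (h : w.getVert i = w.getVert j ∨ G.Adj (w.getVert i) (w.getVert j)) : j ≤ i + 1 := by
  obtain ⟨e, he⟩ : ∃ e : G.Walk (w.getVert i) (w.getVert j), e.length ≤ 1 := by
    rcases h with h | h
    · exact ⟨SimpleGraph.Walk.nil.copy rfl h, by simp⟩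
    · exact ⟨h.toWalk, by simp⟩
  have hle := hw ▸ SimpleGraph.dist_le (((w.take i).append e).append (w.drop j))
  simp only [SimpleGraph.Walk.length_append, SimpleGraph.Walk.take_length,
    SimpleGraph.Walk.drop_length] at hle
  omega

variable {D : Matrix R C ℤ} {s : R → C → ℤˣ} {S : Finset C} {r : R → ℤˣ} {c : C → ℤˣ}

theorem eq_or_eq_add_one_of_length_eq_dist {u v : R} {w : (rowGraph D S).Walk u v}
    (hw : w.length = (rowGraph D S).dist u v) {t m : ℕ} (ht : t < w.length) (hm : m ≤ w.length)
    {j : C} (hj : j ∈ S) (htj : D (w.getVert t) j ≠ 0) (htj' : D (w.getVert (t + 1)) j ≠ 0)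
    (hmj : D (w.getVert m) j ≠ 0) : m = t ∨ m = t + 1 := by
  have hclose k (hkj : D (w.getVert k) j ≠ 0) :
      w.getVert k = w.getVert m ∨ (rowGraph D S).Adj (w.getVert k) (w.getVert m) :=
    or_iff_not_imp_left.2 fun h => rowGraph_adj.2 ⟨h, j, hj, hkj, hmj⟩
  have hle := le_add_one_of_length_eq_dist hw hm (hclose t htj)
  have hge := le_add_one_of_length_eq_dist hw ht
    ((hclose _ htj').imp Eq.symm SimpleGraph.Adj.symm)
  omega

theorem mul_eq_mul_of_length_eq_dist (hD : IsGhouilaHouri D)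
    (hD' : IsGhouilaHouri (.of fun i j => s i j * D i j))
    (hs : ∀ i, ∀ j ∈ S, D i j ≠ 0 → s i j = r i * c j) {u v : R} {w : (rowGraph D S).Walk u v}
    (hw : w.length = (rowGraph D S).dist u v) {a : C}
    (hint : ∀ t ≤ w.length, D (w.getVert t) a ≠ 0 → t = 0 ∨ t = w.length)
    (hu : D u a ≠ 0) (hv : D v a ≠ 0) : r u * s u a = r v * s v a := by
  classical
  let T := (Finset.range (w.length + 1)).image w.getVert
  have hmem t (ht : t ≤ w.length) : w.getVert t ∈ T :=
    Finset.mem_image_of_mem _ (Finset.mem_range_succ_iff.2 ht)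
  obtain ⟨p, hp⟩ := hD.exists_mul_eq_mul hD' T
  have hconst t (ht : t ≤ w.length) : p u * r u = p (w.getVert t) * r (w.getVert t) := by
    induction t with
    | zero => rw [w.getVert_zero]
    | succ t ih =>
      obtain ⟨hne, j, hj, htj, htj'⟩ := rowGraph_adj.1 (w.adj_getVert_succ ht)
      have honly : ∀ l ∈ T, D l j ≠ 0 → l = w.getVert t ∨ l = w.getVert (t + 1) := by
        intro l hl hlj
        obtain ⟨m, hm, rfl⟩ := Finset.mem_image.1 hl
        rcases eq_or_eq_add_one_of_length_eq_dist hw ht (Finset.mem_range_succ_iff.1 hm) hj htj htj'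
          hlj with rfl | rfl
        exacts [.inl rfl, .inr rfl]
      have hpj := hp _ (hmem t (by omega)) _ (hmem _ ht) j hne htj htj' honly
      rw [hs _ j hj htj, hs _ j hj htj', ← mul_assoc, ← mul_assoc] at hpj
      exact (ih (by omega)).trans (mul_right_cancel hpj)
  rcases eq_or_ne u v with rfl | huv
  · rfl
  have hpr := hconst _ le_rfl
  rw [w.getVert_length] at hpr
  have hps := hp u (w.getVert_zero ▸ hmem 0 (by omega)) v (w.getVert_length ▸ hmem _ le_rfl) a huv
    hu hv fun l hl hla => by
      obtain ⟨m, hm, rfl⟩ := Finset.mem_image.1 hl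
      rcases hint m (Finset.mem_range_succ_iff.1 hm) hla with rfl | rfl
      exacts [.inl w.getVert_zero, .inr w.getVert_length]
  have hcancel : p u * p u * (r u * s u a) = p v * p v * (r v * s v a) := by
    rw [mul_mul_mul_comm, hpr, hps, mul_mul_mul_comm]
  simpa only [Int.units_mul_self, one_mul] using hcancel

theorem mul_eq_mul_of_reachable (hD : IsGhouilaHouri D)
    (hD' : IsGhouilaHouri (.of fun i j => s i j * D i j))
    (hs : ∀ i, ∀ j ∈ S, D i j ≠ 0 → s i j = r i * c j) {a : C} {u v : R}
    (huv : (rowGraph D S).Reachable u v) (hu : D u a ≠ 0) (hv : D v a ≠ 0) :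
    r u * s u a = r v * s v a := by
  classical
  induction hn : (rowGraph D S).dist u v using Nat.strong_induction_on generalizing u v with
  | _ n ih =>
    obtain ⟨w, hw⟩ := huv.exists_walk_length_eq_dist
    by_cases hint : ∃ t, 0 < t ∧ t < w.length ∧ D (w.getVert t) a ≠ 0
    · obtain ⟨t, ht0, htn, ht⟩ := hint
      have hleft := SimpleGraph.dist_le (w.take t)
      have hright := SimpleGraph.dist_le (w.drop t)
      rw [SimpleGraph.Walk.take_length] at hleft
      rw [SimpleGraph.Walk.drop_length] at hright
      exact (ih _ (by omega) (w.take t).reachable hu ht rfl).trans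
        (ih _ (by omega) (w.drop t).reachable ht hv rfl)
    · push Not at hint
      refine mul_eq_mul_of_length_eq_dist hD hD' hs hw (fun t ht hta => ?_) hu hv
      by_contra! h
      exact hta (hint t (by omega) (by omega))

theorem exists_rescaling_insert (hD : IsGhouilaHouri D)
    (hD' : IsGhouilaHouri (.of fun i j => s i j * D i j))
    (hs : ∀ i, ∀ j ∈ S, D i j ≠ 0 → s i j = r i * c j) {a : C} (ha : a ∉ S) :
    ∃ (r' : R → ℤˣ) (c' : C → ℤˣ), ∀ i, ∀ j, j = a ∨ j ∈ S → D i j ≠ 0 → s i j = r' i * c' j := by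
  classical
  let G := rowGraph D S
  have hcol : Function.FactorsThrough (fun i : {i // D i a ≠ 0} => r i * s i a)
      (fun i => G.connectedComponentMk i) := fun i k hik =>
    mul_eq_mul_of_reachable hD hD' hs (SimpleGraph.ConnectedComponent.exact hik) i.2 k.2
  obtain ⟨t, ht⟩ : ∃ t : G.ConnectedComponent → ℤˣ,
      ∀ i, D i a ≠ 0 → t (G.connectedComponentMk i) = r i * s i a :=
    ⟨_, fun i hi => hcol.extend_apply 1 ⟨i, hi⟩⟩
  have hrow : Function.FactorsThrough
      (fun x : {x : R × C // x.2 ∈ S ∧ D x.1 x.2 ≠ 0} => t (G.connectedComponentMk x.1.1))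
      (fun x => x.1.2) := by
    rintro ⟨⟨i, j⟩, hj, hij⟩ ⟨⟨k, _⟩, -, hkj⟩ rfl
    rcases eq_or_ne i k with rfl | hik
    · rfl
    · exact congrArg t (SimpleGraph.ConnectedComponent.sound
        (rowGraph_adj.2 ⟨hik, j, hj, hij, hkj⟩).reachable)
  obtain ⟨t', ht'⟩ : ∃ t' : C → ℤˣ,
      ∀ i, ∀ j ∈ S, D i j ≠ 0 → t' j = t (G.connectedComponentMk i) :=
    ⟨_, fun i j hj hij => hrow.extend_apply 1 ⟨⟨i, j⟩, hj, hij⟩⟩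
  refine ⟨fun i => r i * t (G.connectedComponentMk i),
    Function.update (fun j => c j * t' j) a 1, fun i j hj hij => ?_⟩
  by_cases hja : j = a
  · subst hja
    dsimp only
    rw [Function.update_self, ht i hij, mul_one, ← mul_assoc, Int.units_mul_self, one_mul]
  · rw [Function.update_of_ne hja, hs i j (hj.resolve_left hja) hij,
      ht' i j (hj.resolve_left hja) hij, mul_mul_mul_comm, Int.units_mul_self, mul_one]

/-- Camion's theorem. That the signs in a new column are consistent is checked along a shortest path
between two of its rows, on which an earlier column meets at most two consecutive rows. -/
theorem IsGhouilaHouri.exists_eq_mul [Finite C] {D' : Matrix R C ℤ} (hD : IsGhouilaHouri D)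
    (hD' : IsGhouilaHouri D') (hzero : ∀ i j, D i j = 0 ↔ D' i j = 0) :
    ∃ (r : R → ℤˣ) (c : C → ℤˣ), ∀ i j, D' i j = r i * D i j * c j := by
  classical
  have := Fintype.ofFinite C
  have hratio i j : ∃ s : ℤˣ, D' i j = s * D i j := by
    have hij := abs_le.1 (hD.abs_apply_le_one i j)
    have hij' := abs_le.1 (hD'.abs_apply_le_one i j)
    have hzero := hzero i j
    obtain h | h : D' i j = D i j ∨ D' i j = -D i j := by omega
    exacts [⟨1, by simp [h]⟩, ⟨-1, by simp [h]⟩]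
  choose s hs using hratio
  obtain rfl : D' = .of fun i j => s i j * D i j := by ext; exact hs _ _
  suffices h : ∀ S : Finset C, ∃ (r : R → ℤˣ) (c : C → ℤˣ),
      ∀ i, ∀ j ∈ S, D i j ≠ 0 → s i j = r i * c j by
    obtain ⟨r, c, hrc⟩ := h Finset.univ
    refine ⟨r, c, fun i j => ?_⟩
    rcases eq_or_ne (D i j) 0 with h0 | h0
    · simp [h0]
    · rw [hs, hrc i j (Finset.mem_univ j) h0, Units.val_mul, mul_right_comm]
  intro S
  induction S using Finset.induction_on with
  | empty => simp
  | insert a S ha ih =>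
    obtain ⟨r, c, hrc⟩ := ih
    simpa only [Finset.mem_insert] using exists_rescaling_insert hD hD' hrc ha

end Camion

section StandardMatrix

variable {E : Type*} {L L' : AddSubgroup (E → ℤ)} {B : Set E}

/-- The coordinates outside `B` are free parameters of the lattice `L`, and the matrix `D`
expresses the coordinates in `B` through them: `L` is the row lattice of `[1 | D]`. -/
def IsStandardMatrix (L : AddSubgroup (E → ℤ)) (B : Set E) [Fintype ↥Bᶜ] (D : Matrix ↥Bᶜ ↥B ℤ) :
    Prop :=
  ∀ x, x ∈ L ↔ (fun i : ↥Bᶜ => x i) ᵥ* D = fun b : ↥B => x b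

theorem IsRegularLattice.exists_fundamental_vector (hL : IsRegularLattice L)
    (hB : Maximal (SupportIndep L) B) {e : E} (he : e ∉ B) :
    ∃ y ∈ L, y e = 1 ∧ ∀ i ∉ B, i ≠ e → y i = 0 := by
  have hins : ¬ SupportIndep L (insert e B) := fun h =>
    he (hB.le_of_ge h (Set.subset_insert e B) (Set.mem_insert e B))
  simp only [SupportIndep, not_forall] at hins
  obtain ⟨x, hx, hsupp, hx0⟩ := hins
  have hxe : x e ≠ 0 := fun hxe => hx0 <| hB.prop x hx fun i hi => by
    rcases eq_or_ne i e with rfl | hie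
    · exact hxe
    · exact hsupp i (by simp [hi, hie])
  obtain ⟨y, hy, -, hye, hyx⟩ := hL.exists_sign_vector hx hxe
  exact ⟨y, hy, hye, fun i hi hie => hyx i (hsupp i (by simp [hi, hie]))⟩

theorem IsRegularLattice.exists_isStandardMatrix [Fintype ↥Bᶜ] (hL : IsRegularLattice L)
    (hB : Maximal (SupportIndep L) B) : ∃ D, IsStandardMatrix L B D := by
  choose y hy hy1 hy0 using fun e : ↥Bᶜ => hL.exists_fundamental_vector hB e.2
  have hcombo (x : E → ℤ) (i : ↥Bᶜ) : (∑ e : ↥Bᶜ, x e • y e) i = x i := by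
    rw [Finset.sum_apply, Finset.sum_eq_single i]
    · simp [hy1]
    · intro e _ hei
      simp [hy0 e i i.2 fun h => hei (Subtype.ext h.symm)]
    · simp
  have hmem (x : E → ℤ) : x ∈ L ↔ ∑ e : ↥Bᶜ, x e • y e = x := by
    have hcombo_mem : ∑ e : ↥Bᶜ, x e • y e ∈ L := sum_mem fun e _ => zsmul_mem (hy e) _
    refine ⟨fun hx => sub_eq_zero.1 ?_, fun h => h ▸ hcombo_mem⟩
    exact hB.prop _ (sub_mem hcombo_mem hx) fun e he => sub_eq_zero.2 (hcombo x ⟨e, he⟩)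
  refine ⟨.of fun e b => y e b, fun x => (hmem x).trans ⟨fun h => funext fun b => ?_, fun h => ?_⟩⟩
  · simpa [Matrix.vecMul, dotProduct] using congrFun h b
  · funext e
    by_cases he : e ∈ B
    · simpa [Matrix.vecMul, dotProduct] using congrFun h ⟨e, he⟩
    · exact hcombo x ⟨e, he⟩

namespace IsStandardMatrix

variable [Fintype ↥Bᶜ] {D D' : Matrix ↥Bᶜ ↥B ℤ}

theorem exists_mem (hD : IsStandardMatrix L B D) (p : ↥Bᶜ → ℤ) :
    ∃ x ∈ L, (∀ i : ↥Bᶜ, x i = p i) ∧ ∀ b : ↥B, x b = (p ᵥ* D) b := by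
  classical
  let x : E → ℤ := fun e => if h : e ∈ B then (p ᵥ* D) ⟨e, h⟩ else p ⟨e, h⟩
  have hxB (b : ↥B) : x b = (p ᵥ* D) b := dif_pos b.2
  have hxBc (i : ↥Bᶜ) : x i = p i := dif_neg i.2
  refine ⟨x, (hD x).2 ?_, hxBc, hxB⟩
  simp only [hxB, hxBc]

theorem supportIndep (hD : IsStandardMatrix L B D) : SupportIndep L B := by
  intro x hx hsupp
  have hBc : (fun i : ↥Bᶜ => x i) = 0 := funext fun i => hsupp i i.2
  have hxB := (hD x).1 hx
  rw [hBc, Matrix.zero_vecMul] at hxB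
  funext e
  by_cases he : e ∈ B
  · exact (congrFun hxB ⟨e, he⟩).symm
  · exact hsupp e he

theorem apply_ne_zero_iff (hD : IsStandardMatrix L B D) (i : ↥Bᶜ) (b : ↥B) :
    D i b ≠ 0 ↔ SupportIndep L (insert ↑i (B \ {↑b})) := by
  classical
  refine ⟨fun hib x hx hsupp => ?_, fun h hib => ?_⟩
  · have hsupp' (e : E) (he : e ∉ B) (hei : e ≠ i) : x e = 0 := hsupp e (by simp [he, hei])
    have hxb := congrFun ((hD x).1 hx) b
    simp only [Matrix.vecMul, dotProduct] at hxb
    rw [Finset.sum_eq_single i (fun k _ hk => by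
        rw [hsupp' k k.2 (Subtype.coe_ne_coe.2 hk), zero_mul]) (by simp),
      hsupp b (by simp [ne_of_mem_of_not_mem b.2 i.2])] at hxb
    have hxi : x i = 0 := (mul_eq_zero.1 hxb).resolve_right hib
    refine hD.supportIndep x hx fun e he => ?_
    rcases eq_or_ne e i with rfl | hei
    exacts [hxi, hsupp' e he hei]
  · obtain ⟨x, hx, hxBc, hxB⟩ := hD.exists_mem (Pi.single i 1)
    have hx0 : x = 0 := h x hx fun e he => by
      by_cases heB : e ∈ B
      · obtain rfl : e = b := by_contra fun heb => he (by simp [heB, heb])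
        rw [hxB b, Matrix.single_one_vecMul, Matrix.row_apply, hib]
      · have hei : (⟨e, heB⟩ : ↥Bᶜ) ≠ i := fun hei => he (by simp [← hei])
        exact (hxBc ⟨e, heB⟩).trans (Pi.single_eq_of_ne hei 1)
    simpa [hx0] using hxBc i

theorem isGhouilaHouri (hL : IsRegularLattice L) (hD : IsStandardMatrix L B D) :
    IsGhouilaHouri D := by
  classical
  intro T
  obtain ⟨x, hx, hxT, -⟩ := hD.exists_mem fun i => if i ∈ T then 1 else 0
  obtain ⟨y, hy, z, -, hbound, rfl⟩ := hL x hx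
  have hy_of_mem (i : ↥Bᶜ) (hi : i ∈ T) : y i = 1 ∨ y i = -1 := by
    have hyz := hxT i
    have := abs_le.1 (hbound i)
    simp only [Pi.add_apply, Pi.smul_apply, smul_eq_mul, if_pos hi] at hyz
    omega
  have hy_of_notMem (i : ↥Bᶜ) (hi : i ∉ T) : y i = 0 := by
    have hyz := hxT i
    have := abs_le.1 (hbound i)
    simp only [Pi.add_apply, Pi.smul_apply, smul_eq_mul, if_neg hi] at hyz
    omega
  let q (i : ↥Bᶜ) : ℤˣ := if y i = 1 then 1 else -1
  have hq (i : ↥Bᶜ) (hi : i ∈ T) : (q i : ℤ) = y i := by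
    rcases hy_of_mem i hi with h | h <;> simp [q, h]
  refine ⟨q, fun b => ?_⟩
  have hsum : ∑ i ∈ T, (q i : ℤ) * D i b = y b := by
    rw [← congrFun ((hD y).1 hy) b]
    simp only [Matrix.vecMul, dotProduct]
    rw [Finset.sum_congr rfl fun i hi => by rw [hq i hi]]
    exact Finset.sum_subset T.subset_univ fun i _ hi => by rw [hy_of_notMem i hi, zero_mul]
  exact hsum ▸ hbound b

theorem exists_units_smul (hD : IsStandardMatrix L B D) (hD' : IsStandardMatrix L' B D')
    {r : ↥Bᶜ → ℤˣ} {c : ↥B → ℤˣ} (h : ∀ i b, D' i b = r i * D i b * c b) :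
    ∃ ε : E → ℤˣ, ∀ x, x ∈ L ↔ ε • x ∈ L' := by
  classical
  let ε : E → ℤˣ := fun e => if h : e ∈ B then c ⟨e, h⟩ else r ⟨e, h⟩
  have hεB (b : ↥B) : ε b = c b := dif_pos b.2
  have hεBc (i : ↥Bᶜ) : ε i = r i := dif_neg i.2
  refine ⟨ε, fun x => ?_⟩
  rw [hD, hD', funext_iff, funext_iff]
  refine forall_congr' fun b => ?_
  have hsum : ((fun i : ↥Bᶜ => (ε • x) i) ᵥ* D') b = c b * ((fun i : ↥Bᶜ => x i) ᵥ* D) b := by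
    simp only [Matrix.vecMul, dotProduct, Finset.mul_sum, Pi.smul_apply', Units.smul_def,
      smul_eq_mul, h, hεBc]
    refine Finset.sum_congr rfl fun i _ => ?_
    linear_combination (c b * x i * D i b : ℤ) * Int.units_coe_mul_self (r i)
  rw [hsum, Pi.smul_apply', Units.smul_def, hεB, smul_eq_mul, mul_right_inj' (c b).ne_zero]

end IsStandardMatrix

theorem IsRegularLattice.exists_units_smul [Finite E] (hL : IsRegularLattice L)
    (hL' : IsRegularLattice L') (h : ∀ I, SupportIndep L I ↔ SupportIndep L' I) :
    ∃ ε : E → ℤˣ, ∀ x, x ∈ L ↔ ε • x ∈ L' := by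
  classical
  have := Fintype.ofFinite E
  have hempty : SupportIndep L ∅ := fun x _ hx => funext fun e => hx e (Set.notMem_empty e)
  obtain ⟨B, -, hB⟩ := Finite.exists_le_maximal hempty
  have heq : SupportIndep L = SupportIndep L' := funext fun I => propext (h I)
  obtain ⟨D, hD⟩ := hL.exists_isStandardMatrix hB
  obtain ⟨D', hD'⟩ := hL'.exists_isStandardMatrix (heq ▸ hB)
  have hzero i b : D i b = 0 ↔ D' i b = 0 := by
    rw [← not_iff_not, ← ne_eq, ← ne_eq, hD.apply_ne_zero_iff, hD'.apply_ne_zero_iff, h]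
  obtain ⟨r, c, hrc⟩ := (hD.isGhouilaHouri hL).exists_eq_mul (hD'.isGhouilaHouri hL') hzero
  exact hD.exists_units_smul hD' hrc

end StandardMatrix

section Restriction

variable {E F : Type*} {L : AddSubgroup (E → ℤ)} {L' : AddSubgroup (F → ℤ)}

theorem latticeIsometric_map [Fintype E] [Fintype F] {f : (E → ℤ) →+ (F → ℤ)}
    (hf : ∀ x ∈ L, ∀ y ∈ L, f x ⬝ᵥ f y = x ⬝ᵥ y) : LatticeIsometric L (L.map f) := by
  have hinj : Function.Injective (f.addSubgroupMap L) := by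
    refine (injective_iff_map_eq_zero _).2 fun x hx => ?_
    have hfx : f x = 0 := congrArg Subtype.val hx
    have hxx := hf x x.2 x x.2
    rw [hfx, dotProduct_zero, eq_comm, dotProduct_self_eq_zero] at hxx
    exact Subtype.ext hxx
  exact ⟨AddEquiv.ofBijective (f.addSubgroupMap L) ⟨hinj, f.addSubgroupMap_surjective L⟩,
    fun x y => hf x x.2 y y.2⟩

theorem IsRegularLattice.latticeIsometric_of_supportIndep_iff [Fintype E]
    {L L' : AddSubgroup (E → ℤ)} (hL : IsRegularLattice L) (hL' : IsRegularLattice L')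
    (h : ∀ I, SupportIndep L I ↔ SupportIndep L' I) : LatticeIsometric L L' := by
  obtain ⟨ε, hε⟩ := hL.exists_units_smul hL' h
  have hεε (x : E → ℤ) : ε • ε • x = x := by
    rw [smul_smul, show ε * ε = 1 from funext fun e => Int.units_mul_self (ε e), one_smul]
  have hmap : L.map (DistribSMul.toAddMonoidHom (E → ℤ) ε) = L' := by
    ext y
    refine ⟨?_, fun hy => ⟨ε • y, (hε _).2 ((hεε y).symm ▸ hy), hεε y⟩⟩
    rintro ⟨x, hx, rfl⟩
    exact (hε x).1 hx
  refine hmap ▸ latticeIsometric_map fun x _ y _ => Finset.sum_congr rfl fun e _ => ?_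
  change (ε e * x e : ℤ) * (ε e * y e) = x e * y e
  linear_combination (x e * y e : ℤ) * Int.units_coe_mul_self (ε e)

/-- The lattice of the vectors `x ∘ a` with `x ∈ L`: for injective `a` the projection of `L` onto
the coordinates in the range of `a`, for bijective `a` a relabelling of the coordinates. -/
def restrictCoords {κ : Type*} (L : AddSubgroup (E → ℤ)) (a : κ → E) : AddSubgroup (κ → ℤ) :=
  L.map (LinearMap.funLeft ℤ ℤ a).toAddMonoidHom

variable {κ : Type*} {a : κ → E}

theorem isRegularLattice_restrictCoords (hL : IsRegularLattice L) :
    IsRegularLattice (restrictCoords L a) := by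
  rintro _ ⟨x, hx, rfl⟩
  obtain ⟨y, hy, z, hz, hbound, rfl⟩ := hL x hx
  exact ⟨_, ⟨y, hy, rfl⟩, _, ⟨z, hz, rfl⟩, fun i => hbound (a i), rfl⟩

theorem supportIndep_restrictCoords_iff (ha : a.Injective)
    (h0 : ∀ x ∈ L, ∀ e ∉ Set.range a, x e = 0) {I : Set κ} :
    SupportIndep (restrictCoords L a) I ↔ SupportIndep L (a '' I) := by
  refine ⟨fun h x hx hxI => funext fun e => ?_, ?_⟩
  · have hxa : x ∘ a = 0 := h _ ⟨x, hx, rfl⟩ fun i hi => hxI _ (mt ha.mem_set_image.1 hi)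
    by_cases he : e ∈ Set.range a
    · obtain ⟨i, rfl⟩ := he
      exact congrFun hxa i
    · exact h0 x hx e he
  · rintro h _ ⟨x, hx, rfl⟩ hxI
    have hx0 : x = 0 := h x hx fun e he => by
      by_cases hea : e ∈ Set.range a
      · obtain ⟨i, rfl⟩ := hea
        exact hxI i (mt (Set.mem_image_of_mem a) he)
      · exact h0 x hx e hea
    rw [hx0, map_zero]

theorem latticeIsometric_restrictCoords [Fintype E] [Fintype κ] (ha : a.Injective)
    (h0 : ∀ x ∈ L, ∀ e ∉ Set.range a, x e = 0) : LatticeIsometric L (restrictCoords L a) :=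
  latticeIsometric_map fun x hx _ _ =>
    Fintype.sum_of_injective a ha _ _ (fun e he => by rw [h0 x hx e he, zero_mul]) fun _ => rfl

theorem IsRegularLattice.latticeIsometric_iff [Fintype E] [Fintype F] (hL : IsRegularLattice L)
    (hL' : IsRegularLattice L') (hfull : HasFullSupport L) (hfull' : HasFullSupport L') :
    LatticeIsometric L L' ↔ ∃ φ : E ≃ F, ∀ I, SupportIndep L I ↔ SupportIndep L' (φ '' I) := by
  refine ⟨fun h => h.exists_equiv_supportIndep_iff hL hL' hfull hfull', fun ⟨φ, hφ⟩ => ?_⟩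
  have hrange : ∀ x ∈ L', ∀ f ∉ Set.range φ, x f = 0 := fun _ _ f hf =>
    absurd (φ.surjective f) hf
  have hiso : LatticeIsometric L (restrictCoords L' φ) :=
    hL.latticeIsometric_of_supportIndep_iff (isRegularLattice_restrictCoords hL') fun I => by
      rw [hφ, supportIndep_restrictCoords_iff φ.injective hrange]
  exact hiso.trans (latticeIsometric_restrictCoords φ.injective hrange).symm

end Restriction

section SupportMatroid

variable {α β : Type*} {M : Matroid α} {N : Matroid β}

theorem dual_deleteLoops (M : Matroid α) : M.deleteLoops.dual = M.dual.contractColoops := by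
  rw [Matroid.deleteLoops, Matroid.contractColoops, Matroid.dual_delete, Matroid.dual_coloops]

theorem contractColoops_indep_iff {I : Set α} :
    M.contractColoops.Indep I ↔ M.Indep I ∧ Disjoint I M.coloops := by
  rw [Matroid.contractColoops, Matroid.contract_eq_delete_of_subset_coloops subset_rfl,
    Matroid.delete_indep_iff]

/-- The independent sets of the matroid are the sets of coordinates that support no nonzero vector
of the lattice. Flow lattices are paired in this way with the represented matroid, cut lattices with
its dual. -/
def IsSupportMatroid (M : Matroid α) (L : AddSubgroup (M.E → ℤ)) : Prop :=
  ∀ I : Set M.E, M.Indep (Subtype.val '' I) ↔ SupportIndep L I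

theorem exists_supportIndep_not_supportIndep_insert {E : Type*} [Finite E]
    {L : AddSubgroup (E → ℤ)} {x : E → ℤ} (hx : x ∈ L) {e : E} (he : x e ≠ 0) :
    ∃ I, SupportIndep L I ∧ ¬SupportIndep L (insert e I) := by
  induction hn : (Function.support x).ncard using Nat.strong_induction_on generalizing x with
  | _ n ih =>
    by_cases hI : SupportIndep L (Function.support x \ {e})
    · refine ⟨_, hI, fun hins => he (congrFun (hins x hx fun i hi => ?_) e)⟩
      by_contra hxi
      exact hi (or_iff_not_imp_left.2 fun hie => ⟨hxi, hie⟩)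
    · -- Eliminating a coordinate `k` of `x` by means of `y` keeps the entry at `e` nonzero.
      simp only [SupportIndep, not_forall] at hI
      obtain ⟨y, hy, hyx, hy0⟩ := hI
      obtain ⟨k, hk⟩ := Function.ne_iff.1 hy0
      have hye : y e = 0 := hyx e fun h => h.2 rfl
      have hyzero i (hi : x i = 0) : y i = 0 := hyx i fun h => h.1 hi
      have hxk : x k ≠ 0 := mt (hyzero k) hk
      refine ih _ ?_ (sub_mem (zsmul_mem hx (y k)) (zsmul_mem hy (x k))) ?_ rfl
      · rw [← hn]
        refine Set.ncard_lt_ncard ⟨fun i hi hxi => hi ?_, fun hsub => hsub hxk ?_⟩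
        · simp [hxi, hyzero i hxi]
        · simp [mul_comm]
      · simpa [hye, he] using hk

namespace IsSupportMatroid

variable {L : AddSubgroup (M.E → ℤ)} {L' : AddSubgroup (N.E → ℤ)}

theorem apply_eq_zero_of_mem_coloops [Finite M.E] (h : IsSupportMatroid M L) {e : M.E}
    (he : (e : α) ∈ M.coloops) {x : M.E → ℤ} (hx : x ∈ L) : x e = 0 := by
  by_contra hxe
  obtain ⟨I, hI, hins⟩ := exists_supportIndep_not_supportIndep_insert hx hxe
  refine hins ((h _).1 ?_)
  rw [Set.image_insert_eq]
  exact Matroid.IsColoop.insert_indep_of_indep he ((h I).2 hI)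

theorem mem_coloops_iff [Finite M.E] (h : IsSupportMatroid M L) {e : M.E} :
    (e : α) ∈ M.coloops ↔ ∀ x ∈ L, x e = 0 := by
  refine ⟨fun he _ hx => h.apply_eq_zero_of_mem_coloops he hx, fun he => by_contra fun hne => ?_⟩
  obtain ⟨C, hC, heC⟩ := Matroid.exists_mem_isCircuit_of_not_isColoop e.2 hne
  obtain ⟨D, rfl⟩ : ∃ D : Set M.E, Subtype.val '' D = C :=
    Set.subset_range_iff_exists_image_eq.1 (by rw [Subtype.range_coe]; exact hC.subset_ground)
  have hindep := hC.sdiff_singleton_indep heC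
  rw [← Set.image_singleton, ← Set.image_sdiff Subtype.val_injective, h] at hindep
  refine hC.not_indep ((h D).2 fun x hx hxD => hindep x hx fun k hk => ?_)
  obtain rfl | hke := eq_or_ne k e
  · exact he x hx
  · exact hxD k fun hkD => hk ⟨hkD, hke⟩

theorem exists_contractColoops [Fintype M.E] [Fintype M.contractColoops.E]
    (h : IsSupportMatroid M L) (hL : IsRegularLattice L) :
    ∃ L₀ : AddSubgroup (M.contractColoops.E → ℤ), IsSupportMatroid M.contractColoops L₀ ∧
      IsRegularLattice L₀ ∧ HasFullSupport L₀ ∧ LatticeIsometric L L₀ := by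
  let a : M.contractColoops.E → M.E := fun e => ⟨e, e.2.1⟩
  have ha : a.Injective := fun _ _ hee => Subtype.ext (congrArg (fun e : M.E => (e : α)) hee)
  have hrange : ∀ x ∈ L, ∀ e ∉ Set.range a, x e = 0 := fun x hx e he =>
    h.apply_eq_zero_of_mem_coloops (by_contra fun hne => he ⟨⟨e, e.2, hne⟩, rfl⟩) hx
  refine ⟨restrictCoords L a, fun I => ?_, isRegularLattice_restrictCoords hL, fun e => ?_,
    latticeIsometric_restrictCoords ha hrange⟩
  · have hdisj : Disjoint (Subtype.val '' I) M.coloops :=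
      Set.disjoint_left.2 fun _ ⟨e, _, he⟩ => he ▸ e.2.2
    rw [supportIndep_restrictCoords_iff ha hrange, ← h, Set.image_image,
      contractColoops_indep_iff, and_iff_left hdisj]
  · have he : ¬∀ x ∈ L, x (a e) = 0 := mt h.mem_coloops_iff.2 e.2.2
    push Not at he
    obtain ⟨x, hx, hxe⟩ := he
    exact ⟨_, ⟨x, hx, rfl⟩, hxe⟩

theorem latticeIsometric_iff [Fintype M.E] [Fintype N.E] (hM : IsSupportMatroid M L)
    (hN : IsSupportMatroid N L') (hL : IsRegularLattice L) (hL' : IsRegularLattice L') :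
    LatticeIsometric L L' ↔ M.contractColoops.IsIsomorphic N.contractColoops := by
  have : Fintype M.contractColoops.E := (M.E.toFinite.subset Set.sdiff_subset).fintype
  have : Fintype N.contractColoops.E := (N.E.toFinite.subset Set.sdiff_subset).fintype
  obtain ⟨L₀, hM₀, hL₀, hfull, hiso⟩ := hM.exists_contractColoops hL
  obtain ⟨L₀', hN₀, hL₀', hfull', hiso'⟩ := hN.exists_contractColoops hL'
  calc LatticeIsometric L L'
      ↔ LatticeIsometric L₀ L₀' :=
        ⟨fun h => (hiso.symm.trans h).trans hiso', fun h => (hiso.trans h).trans hiso'.symm⟩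
    _ ↔ ∃ φ : M.contractColoops.E ≃ N.contractColoops.E,
          ∀ I, SupportIndep L₀ I ↔ SupportIndep L₀' (φ '' I) :=
        hL₀.latticeIsometric_iff hL₀' hfull hfull'
    _ ↔ M.contractColoops.IsIsomorphic N.contractColoops :=
        exists_congr fun φ => forall_congr' fun I => by rw [hM₀, hN₀]

end IsSupportMatroid

end SupportMatroid

section Representation

theorem span_eq_top_iff_forall_dotProduct {K n : Type*} [Field K] [Fintype n] {S : Set (n → K)} :
    Submodule.span K S = ⊤ ↔ ∀ p : n → K, (∀ v ∈ S, p ⬝ᵥ v = 0) → p = 0 := by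
  classical
  rw [← Submodule.dualAnnihilator_eq_bot_iff, Submodule.eq_bot_iff,
    (dotProductEquiv K n).surjective.forall]
  refine forall_congr' fun p => ?_
  rw [map_eq_zero_iff _ (dotProductEquiv K n).injective, ← SetLike.mem_coe,
    Submodule.coe_dualAnnihilator_span]
  rfl

variable {α : Type*} {M : Matroid α} [Fintype M.E] {r : ℕ} {A : Matrix (Fin r) M.E ℤ}

theorem isSupportMatroid_flowLattice (h : M.IsTURepresentation A) :
    IsSupportMatroid M (flowLattice A) := fun I => by
  rw [h.indep_iff, linearIndepOn_col_iff]
  exact (hasRounding_ker h.isTotallyUnimodular).supportIndep_iff.symm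

theorem span_range_col_eq_top (h : M.IsTURepresentation A) :
    Submodule.span ℝ (Set.range (A.map (Int.cast : ℤ → ℝ)).col) = ⊤ := by
  apply Submodule.eq_top_of_finrank_eq
  rw [← Matrix.rank_eq_finrank_span_cols, h.rank_eq, Module.finrank_fin_fun]

theorem isBase_iff_of_isTURepresentation (h : M.IsTURepresentation A) {J : Set M.E} :
    M.IsBase (Subtype.val '' J) ↔ LinearIndepOn ℝ (A.map (Int.cast : ℤ → ℝ)).col J ∧
      Submodule.span ℝ ((A.map (Int.cast : ℤ → ℝ)).col '' J) = ⊤ := by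
  refine ⟨fun hJ => ?_, fun ⟨hJ, hspan⟩ => ?_⟩
  · have hindep := (h.indep_iff J).1 hJ.indep
    refine ⟨hindep, ?_⟩
    rw [eq_top_iff, ← span_range_col_eq_top h, Submodule.span_le]
    rintro _ ⟨e, rfl⟩
    by_contra he
    obtain ⟨hins, heJ⟩ := hindep.notMem_span_iff.1 he
    rw [← h.indep_iff, Set.image_insert_eq] at hins
    exact heJ (Subtype.val_injective.mem_set_image.1 (hJ.mem_of_insert_indep hins))
  · refine ((h.indep_iff J).2 hJ).isBase_of_forall_insert fun e he hins => ?_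
    lift e to M.E using he.1
    rw [← Set.image_insert_eq, h.indep_iff,
      linearIndepOn_insert (mt (Set.mem_image_of_mem _) he.2), hspan] at hins
    exact hins.2 Submodule.mem_top

theorem spanning_iff_of_isTURepresentation (h : M.IsTURepresentation A) {J : Set M.E} :
    M.Spanning (Subtype.val '' J) ↔
      Submodule.span ℝ ((A.map (Int.cast : ℤ → ℝ)).col '' J) = ⊤ := by
  refine ⟨fun hJ => ?_, fun hspan => ?_⟩
  · obtain ⟨B, hB, hBJ⟩ := hJ.exists_isBase_subset
    obtain ⟨I, hIJ, rfl⟩ := Set.subset_image_iff.1 hBJ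
    rw [eq_top_iff, ← ((isBase_iff_of_isTURepresentation h).1 hB).2]
    exact Submodule.span_mono (Set.image_mono hIJ)
  · obtain ⟨I, hIJ, -, hJI, hI⟩ := exists_linearIndepOn_extension
      (linearIndepOn_empty ℝ (A.map (Int.cast : ℤ → ℝ)).col) (Set.empty_subset J)
    have hbase : M.IsBase (Subtype.val '' I) := (isBase_iff_of_isTURepresentation h).2
      ⟨hI, by rw [eq_top_iff, ← hspan]; exact Submodule.span_le.2 hJI⟩
    exact hbase.spanning_of_superset (Set.image_mono hIJ) (Subtype.coe_image_subset _ _)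

theorem isSupportMatroid_dual_cutLattice (h : M.IsTURepresentation A) :
    IsSupportMatroid M.dual (cutLattice A) := fun (I : Set M.E) => by
  have hcompl : M.E \ Subtype.val '' I = Subtype.val '' Iᶜ := by
    rw [Set.image_compl_eq_range_sdiff_image Subtype.val_injective, Subtype.range_coe]
  have hrow (p : Fin r → ℝ) (hp : p ᵥ* A.map (Int.cast : ℤ → ℝ) = 0) : p = 0 :=
    span_eq_top_iff_forall_dotProduct.1 (span_range_col_eq_top h) p
      (Set.forall_mem_range.2 (congrFun hp))
  calc M.dual.Indep (Subtype.val '' I)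
      ↔ M.Spanning (Subtype.val '' Iᶜ) := by
        rw [← hcompl, ← Matroid.coindep_iff_compl_spanning (Subtype.coe_image_subset _ _)]
    _ ↔ ∀ p : Fin r → ℝ, (∀ e ∉ I, (p ᵥ* A.map (Int.cast : ℤ → ℝ)) e = 0) → p = 0 := by
        rw [spanning_iff_of_isTURepresentation h, span_eq_top_iff_forall_dotProduct]
        simp only [Set.forall_mem_image]
        rfl
    _ ↔ ∀ p : Fin r → ℝ, (∀ e ∉ I, (p ᵥ* A.map (Int.cast : ℤ → ℝ)) e = 0) →
          p ᵥ* A.map (Int.cast : ℤ → ℝ) = 0 :=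
        forall₂_congr fun p _ => ⟨fun hp => hp ▸ Matrix.zero_vecMul _, hrow p⟩
    _ ↔ ∀ z ∈ Submodule.span ℝ (Set.range (A.map (Int.cast : ℤ → ℝ)).row),
          (∀ e ∉ I, z e = 0) → z = 0 := by
        simp only [← range_vecMulLinear, LinearMap.mem_range, forall_exists_index,
          forall_apply_eq_imp_iff, Matrix.vecMulLinear_apply]
    _ ↔ SupportIndep (cutLattice A) I :=
        (hasRounding_span_row h.isTotallyUnimodular).supportIndep_iff.symm

end Representation

/-- For regular matroids `M` and `N` one has `(N°)* = (N*)_•`, and the flow lattice of `M` and the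
cut lattice of `N`, formed from any totally unimodular representations, are isometric if and only
if `M_•` and `(N°)*` are isomorphic. -/
theorem mainTheorem9 {α β : Type*} (M : Matroid α) (N : Matroid β) [Fintype M.E] [Fintype N.E]
    (hM : M.IsRegular) (hN : N.IsRegular) :
    N.deleteLoops.dual = N.dual.contractColoops ∧
    ∀ (r s : ℕ) (A : Matrix (Fin r) M.E ℤ) (B : Matrix (Fin s) N.E ℤ),
      M.IsTURepresentation A → N.IsTURepresentation B →
        (LatticeIsometric (flowLattice A) (cutLattice B) ↔
          M.contractColoops.IsIsomorphic N.deleteLoops.dual) := by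
  refine ⟨dual_deleteLoops N, fun r s A B hA hB => ?_⟩
  rw [dual_deleteLoops]
  let _ : Fintype N.dual.E := inferInstanceAs (Fintype N.E)
  have hflow : IsRegularLattice (flowLattice A) :=
    (hasRounding_ker hA.isTotallyUnimodular).isRegularLattice
  have hcut : IsRegularLattice (cutLattice B) :=
    (hasRounding_span_row hB.isTotallyUnimodular).isRegularLattice
  exact (isSupportMatroid_flowLattice hA).latticeIsometric_iff
    (isSupportMatroid_dual_cutLattice hB) hflow hcut
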